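/- Conventions. A forcing poset $\mathbb P$ is a nonempty preordered set; $q\le p$ means that $q$ is stronger, and $p,q$ are incompatible if they have no common lower bound. For a cardinal $\mu$, a poset is $\mu$-c.c. if each of its antichains (sets of pairwise incompatible conditions) has size less than $\mu$; $\mathbb P$ is nowhere $\mu$-c.c. if for no $p\in\mathbb P$ is $\{q\in\mathbb P: q\le p\}$ $\mu$-c.c. In the game $\mathcal G^{\mathrm I}_\delta(\mathbb P)$ two players build a descending sequence in $\mathbb P$; in each round $\alpha$ (including limit $\alpha$) Player I plays some $s_\alpha$ below all earlier moves and then Player II plays some $t_\alpha\le s_\alpha$. Player II wins if the game lasts for $\delta$ many rounds, and otherwise Player I wins. $\mathbb P$ is strongly $\kappa$-strategically closed if Player II has a winning strategy in $\mathcal G^{\mathrm I}_\kappa(\mathbb P)$. $\mathbb P$ collapses $\mu$ to $\kappa$ if it is forced by every condition that there is a surjection from $\kappa$ onto $\mu$. $\mathrm{Col}(\kappa,\mu)$ is the set of partial functions from $\kappa$ to $\mu$ of size less than $\kappa$, ordered by reverse inclusion. Two posets are forcing-equivalent if their Boolean completions (algebras of regular open sets) are isomorphic. Lemma. Let $\kappa$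 be an infinite cardinal and $\mathbb P$ a forcing poset. If $\mathbb P$ is strongly $\kappa$-strategically closed and nowhere $|\mathbb P|$-c.c., and $\mathbb P$ collapses $|\mathbb P|$ to $\kappa$, then $\mathbb P$ is forcing-equivalent to $\mathrm{Col}(\kappa,|\mathbb P|)$. -/

import Mathlib

universe u v

namespace Forcing

/-! ### Compatibility and chain conditions -/

/-- Two conditions are incompatible if they have no common extension
(`q ≤ p` means that `q` is the stronger condition). -/
def Incompatible {P : Type u} [Preorder P] (p q : P) : Prop :=
  ¬ ∃ r : P, r ≤ p ∧ r ≤ q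

/-- The `μ`-chain condition: every antichain (set of pairwise incompatible conditions)
has cardinality less than `μ`. -/
def HasChainCondition (P : Type u) [Preorder P] (μ : Cardinal.{u}) : Prop :=
  ∀ A : Set P, A.Pairwise Incompatible → Cardinal.mk A < μ

/-- `P` is nowhere `μ`-c.c.: for no condition `p` does the poset `{q | q ≤ p}` have the
`μ`-chain condition. -/
def NowhereChainCondition (P : Type u) [Preorder P] (μ : Cardinal.{u}) : Prop :=
  ∀ p : P, ¬ HasChainCondition (Set.Iic p) μ

/-! ### The game in which Player I plays first in every round

In round `α` Player I plays `s α`, then Player II plays `t α`; the moves descend: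
`s α ≤ t β` for all `β < α`, and `t α ≤ s α`.  Player I moves first in all rounds, including
those with a limit index.  Player II wins iff the game lasts for `δ` many rounds. -/

/-- A strategy for Player II: given the rounds played before round `α` (as pairs of a move of
Player I and a move of Player II) and the move of Player I in round `α`, the answer of
Player II. -/
abbrev StrategyII (P : Type u) : Type (max u (v + 1)) :=
  ∀ α : Ordinal.{v}, (Set.Iio α → P × P) → P → P

/-- The first `γ` rounds of `run` form a partial play in which Player I always makes legal
moves and Player II plays according to `τ`.  The values of `run` from `γ` on are
irrelevant (posets of conditions are nonempty). -/
def FollowsUpTo {P : Type u} [Preorder P] (τ : StrategyII.{u, v} P) (γ : Ordinal.{v})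
    (run : Ordinal.{v} → P × P) : Prop :=
  ∀ α < γ, (∀ β < α, (run α).1 ≤ (run β).2) ∧
    (run α).2 = τ α (fun β => run β.1) (run α).1

/-- `τ` is a winning strategy for Player II in the game of length `δ`: whenever fewer than `δ`
rounds have been played with Player II following `τ`, Player I has a legal move, and every
answer given by `τ` is legal.  Hence the game cannot stop before `δ` rounds are played. -/
def IsWinningII {P : Type u} [Preorder P] (τ : StrategyII.{u, v} P) (δ : Ordinal.{v}) : Prop :=
  ∀ (γ : Ordinal.{v}) (run : Ordinal.{v} → P × P), γ < δ → FollowsUpTo τ γ run →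
    (∃ p : P, ∀ β < γ, p ≤ (run β).2) ∧
    ∀ p : P, (∀ β < γ, p ≤ (run β).2) → τ γ (fun β => run β.1) p ≤ p

/-- `P` is strongly `κ`-strategically closed: Player II has a winning strategy in the game of
length `κ` in which Player I plays first at limit stages. -/
def StronglyStrategicallyClosed (P : Type u) [Preorder P] (κ : Cardinal.{v}) : Prop :=
  ∃ τ : StrategyII.{u, v} P, IsWinningII τ κ.ord

/-! ### Names for functions between ground model sets, and collapsing -/

/-- A (nice) `P`-name for a subset of the ground model set `X`: a set of pairs `(s, x)`.
Its interpretation by a generic filter `G` is `{x | ∃ s ∈ G, (s, x) ∈ τ}`. -/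
abbrev SubsetName (P : Type u) (X : Type v) : Type (max u v) := Set (P × X)

/-- The forcing relation `p ⊩ x ∈ τ`: the conditions lying below some `s` with `(s, x) ∈ τ` are
dense below `p`. -/
def ForcesMem {P : Type u} [Preorder P] {X : Type v} (p : P) (x : X) (τ : SubsetName P X) :
    Prop :=
  ∀ q ≤ p, ∃ r ≤ q, ∃ s : P, (s, x) ∈ τ ∧ r ≤ s

/-- `p ⊩ "τ is a function from X onto Y"`, with the forcing relation unfolded. -/
structure ForcesSurjection {P : Type u} [Preorder P] {X Y : Type v} (p : P)
    (τ : SubsetName P (X × Y)) : Prop where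
  /-- `p ⊩ ∀ x ∈ X, ∃ y ∈ Y, (x, y) ∈ τ` -/
  total : ∀ x : X, ∀ q ≤ p, ∃ r ≤ q, ∃ y : Y, ForcesMem r (x, y) τ
  /-- `p ⊩ ∀ x ∈ X, ∀ y y' ∈ Y, (x, y) ∈ τ ∧ (x, y') ∈ τ → y = y'` -/
  functional : ∀ (x : X) (y y' : Y), ∀ q ≤ p,
    ForcesMem q (x, y) τ → ForcesMem q (x, y') τ → y = y'
  /-- `p ⊩ ∀ y ∈ Y, ∃ x ∈ X, (x, y) ∈ τ` -/
  surjective : ∀ y : Y, ∀ q ≤ p, ∃ r ≤ q, ∃ x : X, ForcesMem r (x, y) τ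

/-- `P` collapses `μ` to `κ`: there is a `P`-name that every condition forces to be a function
from `κ` onto `μ`. -/
def Collapses (P : Type u) [Preorder P] (μ κ : Cardinal.{v}) : Prop :=
  ∃ τ : SubsetName P (κ.ord.ToType × μ.ord.ToType), ∀ p : P, ForcesSurjection p τ

/-! ### The Levy collapse -/

/-- Conditions of `Col(κ, μ)`: partial functions from `κ` to `μ` whose domain has size less
than `κ`. -/
@[ext]
structure Col (κ μ : Cardinal.{u}) : Type u where
  /-- The partial function; `none` means undefined. -/
  toFun : κ.ord.ToType → Option μ.ord.ToType
  card_dom_lt : Cardinal.mk {a : κ.ord.ToType // toFun a ≠ none} < κ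

/-- `q ≤ p` iff the partial function `q` extends `p`. -/
instance Col.instPartialOrder (κ μ : Cardinal.{u}) : PartialOrder (Col κ μ) where
  le q p := ∀ a b, p.toFun a = some b → q.toFun a = some b
  le_refl _ _ _ h := h
  le_trans _ _ _ h₁ h₂ a b h := h₁ a b (h₂ a b h)
  le_antisymm q p h₁ h₂ := by
    ext a b
    exact ⟨h₂ a b, h₁ a b⟩

/-! ### Forcing equivalence -/

/-- The Boolean completion of `P`: the Boolean algebra of regular open subsets of `P`, i.e. of
those downward closed sets `U` which contain every `p` below which `U` is dense (the regular
elements `U = ¬¬U` of the Heyting algebra of all downward closed sets). -/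
abbrev BooleanCompletion (P : Type u) [Preorder P] : Type u :=
  Heyting.Regular (LowerSet P)

/-- Two posets are forcing-equivalent if their Boolean completions are isomorphic. -/
def ForcingEquivalent (P : Type u) (Q : Type v) [Preorder P] [Preorder Q] : Prop :=
  Nonempty (BooleanCompletion P ≃o BooleanCompletion Q)

end Forcing

namespace Forcing

/-! ### Dense embeddings and Boolean completions -/

section DenseEmbedding

variable {P : Type u} [Preorder P] {T : Type v} [Preorder T]

/-! Write μ = |P| and read the collapsing name as a name for a surjection from κ onto P itself. Grow
a tree of plays along a winning strategy for Player II. After each history, since P is nowhere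
μ-c.c., the answers of Player II can be arranged into a maximal antichain of size μ below that
history. In round α Player I also moves into the dense set of conditions which decide the α-th value
of the surjection and are either below that value or incompatible with it (`PlayTree`, `deciding`).

Strategic closure gives distributivity, so every level of the tree is predense
(`isOpenDense_level`). Any p can be forced by some r ≤ p to be the x-th value. A level-x node
compatible with r decides that value to be p and is compatible with p, hence lies below p. So the
tree is dense in P.

Density of the tree also forces κ to be regular (`le_cof_ord`). For regular κ the same tree, seen as
functions into μ on initial segments of κ with a last element, is dense in the Levy collapse. Dense
embeddings preserve Boolean completions, so both posets have the completion of the tree. -/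

theorem Incompatible.mono {p q p' q' : P} (h : Incompatible p q) (hp : p' ≤ p) (hq : q' ≤ q) :
    Incompatible p' q' :=
  fun ⟨r, h₁, h₂⟩ => h ⟨r, h₁.trans hp, h₂.trans hq⟩

theorem Incompatible.symm {p q : P} (h : Incompatible p q) : Incompatible q p :=
  fun ⟨r, h₁, h₂⟩ => h ⟨r, h₂, h₁⟩

theorem mem_compl_lowerSet {U : LowerSet P} {p : P} : p ∈ Uᶜ ↔ ∀ q ≤ p, q ∉ U := by
  rw [← LowerSet.Iic_le, le_compl_iff_disjoint_right]
  constructor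
  · intro h q hq hU
    have := h (LowerSet.Iic_le.2 (LowerSet.mem_Iic_iff.2 hq)) (LowerSet.Iic_le.2 hU)
    exact (LowerSet.Iic_le.1 this : q ∈ (⊥ : LowerSet P))
  · intro h V hV hU q hq
    exact (h q (LowerSet.mem_Iic_iff.1 (hV hq)) (hU hq)).elim

theorem isRegular_lowerSet_iff {U : LowerSet P} :
    Heyting.IsRegular U ↔ ∀ p, (∀ q ≤ p, ∃ r ≤ q, r ∈ U) → p ∈ U := by
  have key : ∀ p, p ∈ Uᶜᶜ ↔ ∀ q ≤ p, ∃ r ≤ q, r ∈ U := by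
    intro p
    simp only [mem_compl_lowerSet]
    push Not
    rfl
  constructor
  · intro h p hp
    rw [← h.eq]
    exact (key p).2 hp
  · intro h
    exact le_antisymm (fun p hp => h p ((key p).1 hp)) le_compl_compl

/-- A map that preserves the order and incompatibility and has dense range. -/
structure IsDenseEmbedding (e : T → P) : Prop where
  mono : Monotone e
  incompatible : ∀ s t, Incompatible s t → Incompatible (e s) (e t)
  dense : ∀ p, ∃ t, e t ≤ p

variable {e : T → P}

theorem IsDenseEmbedding.compatible (he : IsDenseEmbedding e) {s t : T} {r : P}
    (h₁ : r ≤ e s) (h₂ : r ≤ e t) : ∃ x, x ≤ s ∧ x ≤ t := by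
  by_contra h
  exact he.incompatible s t h ⟨r, h₁, h₂⟩

/-- The preimage of a regular open set under a dense embedding. -/
def IsDenseEmbedding.comap (he : IsDenseEmbedding e) (U : BooleanCompletion P) :
    BooleanCompletion T :=
  ⟨⟨{t | e t ∈ U.1}, fun _ _ h hs => U.1.lower (he.mono h) hs⟩, isRegular_lowerSet_iff.2 (by
    intro t ht
    refine isRegular_lowerSet_iff.1 U.2 _ fun q hq => ?_
    obtain ⟨s, hs⟩ := he.dense q
    obtain ⟨x, hxs, hxt⟩ := he.compatible le_rfl (hs.trans hq)
    obtain ⟨y, hy, hyU⟩ := ht x hxt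
    exact ⟨e y, (he.mono (hy.trans hxs)).trans hs, hyU⟩)⟩

/-- The regular open set generated by the image of a regular open set. -/
def IsDenseEmbedding.map (he : IsDenseEmbedding e) (V : BooleanCompletion T) :
    BooleanCompletion P :=
  ⟨⟨{p | ∀ t, e t ≤ p → t ∈ V.1}, fun _ _ h hs t ht => hs t (ht.trans h)⟩,
    isRegular_lowerSet_iff.2 (by
      intro p hp t ht
      refine isRegular_lowerSet_iff.1 V.2 _ fun s hs => ?_
      obtain ⟨r, hr, hrW⟩ := hp (e s) ((he.mono hs).trans ht)
      obtain ⟨x, hx⟩ := he.dense r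
      obtain ⟨y, hyx, hys⟩ := he.compatible le_rfl (hx.trans hr)
      exact ⟨y, hys, V.1.lower hyx (hrW x hx)⟩)⟩

/-- A dense embedding induces an isomorphism of Boolean completions. -/
def IsDenseEmbedding.orderIso (he : IsDenseEmbedding e) :
    BooleanCompletion P ≃o BooleanCompletion T :=
  have gc : ∀ U V, he.comap U ≤ V ↔ U ≤ he.map V := fun U V =>
    ⟨fun h p hp t ht => h (show e t ∈ U.1 from U.1.lower ht hp), fun h t ht => h ht t le_rfl⟩
  have map_le : ∀ U, he.map (he.comap U) ≤ U := fun U p hp => by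
    refine isRegular_lowerSet_iff.1 U.2 _ fun q hq => ?_
    obtain ⟨t, ht⟩ := he.dense q
    exact ⟨e t, ht, hp t (ht.trans hq)⟩
  have le_comap : ∀ V, V ≤ he.comap (he.map V) := fun V t ht s hs => by
    refine isRegular_lowerSet_iff.1 V.2 _ fun x hx => ?_
    obtain ⟨y, hyx, hyt⟩ := he.compatible le_rfl ((he.mono hx).trans hs)
    exact ⟨y, hyx, V.1.lower hyt ht⟩
  { toFun := he.comap
    invFun := he.map
    left_inv := fun U => le_antisymm (map_le U) ((gc _ _).1 le_rfl)
    right_inv := fun V => le_antisymm ((gc _ _).2 le_rfl) (le_comap V)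
    map_rel_iff' := fun {U V} => ⟨fun h => ((gc _ _).1 h).trans (map_le V),
      fun h _ ht => h ht⟩ }

end DenseEmbedding

/-! ### Plays against a strategy -/

section Play

variable {P : Type u}

/-- The play in which Player I moves according to `c` and Player II according to `τ`. -/
noncomputable def play (τ : StrategyII.{u, v} P)
    (c : ∀ γ : Ordinal.{v}, (Set.Iio γ → P × P) → P) : Ordinal.{v} → P × P :=
  WellFounded.fix (C := fun _ => P × P) wellFounded_lt fun γ ih =>
    let h : Set.Iio γ → P × P := fun β => ih β.1 β.2
    (c γ h, τ γ h (c γ h))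

theorem play_eq (τ : StrategyII.{u, v} P) (c : ∀ γ : Ordinal.{v}, (Set.Iio γ → P × P) → P)
    (γ : Ordinal.{v}) :
    play τ c γ = (c γ (fun β => play τ c β.1),
      τ γ (fun β => play τ c β.1) (c γ (fun β => play τ c β.1))) := by
  rw [play, WellFounded.fix_eq]

theorem play_snd (τ : StrategyII.{u, v} P) (c : ∀ γ : Ordinal.{v}, (Set.Iio γ → P × P) → P)
    (γ : Ordinal.{v}) :
    (play τ c γ).2 = τ γ (fun β => play τ c β.1) (play τ c γ).1 := by
  rw [play_eq]

theorem play_fst (τ : StrategyII.{u, v} P) (c : ∀ γ : Ordinal.{v}, (Set.Iio γ → P × P) → P)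
    (γ : Ordinal.{v}) : (play τ c γ).1 = c γ (fun β => play τ c β.1) := by
  rw [play_eq]

variable [Preorder P] {τ : StrategyII.{u, v} P} {δ : Ordinal.{v}}

theorem FollowsUpTo.mono {γ γ' : Ordinal.{v}} {run : Ordinal.{v} → P × P}
    (h : FollowsUpTo τ γ run) (hγ : γ' ≤ γ) : FollowsUpTo τ γ' run :=
  fun α hα => h α (hα.trans_le hγ)

theorem followsUpTo_play {c : ∀ γ : Ordinal.{v}, (Set.Iio γ → P × P) → P}
    (hc : ∀ γ < δ, FollowsUpTo τ γ (play τ c) → ∀ β < γ, (play τ c γ).1 ≤ (play τ c β).2) :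
    FollowsUpTo τ δ (play τ c) := by
  intro α
  induction α using WellFoundedLT.induction with
  | ind α ih =>
    intro hα
    exact ⟨hc α hα fun β hβ => ih β hβ (hβ.trans hα), play_snd τ c α⟩

theorem IsWinningII.snd_le_fst (hτ : IsWinningII τ δ) {run : Ordinal.{v} → P × P}
    (h : FollowsUpTo τ δ run) {α : Ordinal.{v}} (hα : α < δ) : (run α).2 ≤ (run α).1 := by
  rw [(h α hα).2]
  exact (hτ α run hα (h.mono hα.le)).2 _ (h α hα).1

theorem IsWinningII.antitone (hτ : IsWinningII τ δ) {run : Ordinal.{v} → P × P}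
    (h : FollowsUpTo τ δ run) {α β : Ordinal.{v}} (hα : α < δ) (hβ : β ≤ α) :
    (run α).2 ≤ (run β).2 := by
  rcases hβ.eq_or_lt with rfl | hβ
  · exact le_rfl
  · exact (hτ.snd_le_fst h hα).trans ((h α hα).1 β hβ)

/-- A set of conditions that is open (downward closed) and dense. -/
structure IsOpenDense (D : Set P) : Prop where
  lower : IsLowerSet D
  dense : ∀ p, ∃ q ≤ p, q ∈ D

/-- Strategic closure implies distributivity. -/
theorem IsWinningII.distributive (hτ : IsWinningII τ δ) {γ : Ordinal.{v}} (hγ : γ < δ)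
    {U : Ordinal.{v} → Set P} (hU : ∀ β < γ, IsOpenDense (U β)) (p : P) :
    ∃ q ≤ p, ∀ β < γ, q ∈ U β := by
  -- The implication makes the choice total: where no suitable move exists, nothing is asked of x.
  have hstep : ∀ (α : Ordinal.{v}) (h : Set.Iio α → P × P), ∃ x : P,
      (∃ y ≤ p, (∀ β, y ≤ (h β).2) ∧ y ∈ U α) → x ≤ p ∧ (∀ β, x ≤ (h β).2) ∧ x ∈ U α := by
    intro α h
    by_cases hx : ∃ y ≤ p, (∀ β, y ≤ (h β).2) ∧ y ∈ U α
    · obtain ⟨y, hy⟩ := hx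
      exact ⟨y, fun _ => hy⟩
    · exact ⟨p, fun h => (hx h).elim⟩
  choose c hc using hstep
  have hrun : ∀ α ≤ γ, FollowsUpTo τ α (play τ c) ∧
      ∀ β < α, (play τ c β).1 ≤ p ∧ (play τ c β).1 ∈ U β := by
    intro α
    induction α using WellFoundedLT.induction with
    | ind α ih =>
      intro hα
      have main : ∀ β < α, (∀ ξ < β, (play τ c β).1 ≤ (play τ c ξ).2) ∧
          (play τ c β).1 ≤ p ∧ (play τ c β).1 ∈ U β := by
        intro β hβ
        obtain ⟨hf, hp⟩ := ih β hβ (hβ.le.trans hα)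
        have hβγ := hβ.trans_le hα
        have hex : ∃ y ≤ p, ∀ ξ < β, y ≤ (play τ c ξ).2 := by
          -- The empty history does not bound the first move by p, so at round 0 the bound is p
          -- itself; later it is inherited from round 0.
          rcases eq_zero_or_pos β with rfl | h0
          · exact ⟨p, le_rfl, fun ξ hξ => absurd hξ not_lt_zero⟩
          · obtain ⟨y, hy⟩ := (hτ β _ (hβγ.trans hγ) hf).1
            refine ⟨y, (hy 0 h0).trans (le_trans ?_ (hp 0 h0).1), hy⟩
            have := (hτ 0 (play τ c) ((h0.trans hβγ).trans hγ) (hf.mono h0.le)).2 (play τ c 0).1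
              (hf 0 h0).1
            rwa [play_snd]
        obtain ⟨y, hyp, hy⟩ := hex
        obtain ⟨z, hzy, hz⟩ := (hU β hβγ).dense y
        have := hc β (fun ξ => play τ c ξ.1)
          ⟨z, hzy.trans hyp, fun ξ => hzy.trans (hy ξ.1 ξ.2), hz⟩
        rw [← play_fst τ c β] at this
        exact ⟨fun ξ hξ => this.2.1 ⟨ξ, hξ⟩, this.1, this.2.2⟩
      exact ⟨fun β hβ => ⟨(main β hβ).1, play_snd τ c β⟩, fun β hβ => (main β hβ).2⟩
  obtain ⟨hf, hp⟩ := hrun γ le_rfl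
  rcases eq_zero_or_pos γ with rfl | h0
  · exact ⟨p, le_rfl, fun ξ hξ => absurd hξ not_lt_zero⟩
  have hle : ∀ β < γ, (play τ c β).2 ≤ (play τ c β).1 := by
    intro β hβ
    rw [play_snd]
    exact (hτ β _ (hβ.trans hγ) (hf.mono hβ.le)).2 _ (hf β hβ).1
  obtain ⟨y, hy⟩ := (hτ γ _ hγ hf).1
  exact ⟨y, (hy 0 h0).trans ((hle 0 h0).trans (hp 0 h0).1), fun β hβ =>
    (hU β hβ).lower ((hy β hβ).trans (hle β hβ)) (hp β hβ).2⟩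

end Play

/-! ### Maximal antichains of answers -/

section Step

variable {P : Type u} [Preorder P] {τ : StrategyII.{u, v} P} {δ : Ordinal.{v}}

/-- Legal moves of Player I in the set `D`, indexed by `M`, such that the answers given by `τ`
form a maximal antichain below the history. -/
theorem IsWinningII.exists_maximal_antichain (hτ : IsWinningII τ δ)
    (hcc : NowhereChainCondition P (Cardinal.mk P)) {M : Type u}
    (hM : Cardinal.mk M = Cardinal.mk P) {γ : Ordinal.{v}} (hγ : γ < δ)
    {run : Ordinal.{v} → P × P} (hrun : FollowsUpTo τ γ run) {D : Set P}
    (hD : IsOpenDense D) :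
    ∃ c : M → P, (∀ m, ∀ β < γ, c m ≤ (run β).2) ∧ (∀ m, c m ∈ D) ∧
      (∀ m n, m ≠ n → Incompatible (τ γ (fun β => run β.1) (c m))
        (τ γ (fun β => run β.1) (c n))) ∧
      ∀ p, (∀ β < γ, p ≤ (run β).2) →
        ∃ m, ∃ r, r ≤ p ∧ r ≤ τ γ (fun β => run β.1) (c m) := by
  obtain ⟨⟨p₀, hp₀⟩, ht⟩ := hτ γ run hγ hrun
  set t : P → P := τ γ (fun β => run β.1) with ht_def
  let R : Set P := {x | (∀ β < γ, x ≤ (run β).2) ∧ x ∈ D}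
  have hR : ∀ p, (∀ β < γ, p ≤ (run β).2) → ∃ x ∈ R, x ≤ p := by
    intro p hp
    obtain ⟨x, hx, hxD⟩ := hD.dense p
    exact ⟨x, ⟨fun β hβ => hx.trans (hp β hβ), hxD⟩, hx⟩
  have hA := hcc p₀
  simp only [HasChainCondition] at hA
  push Not at hA
  obtain ⟨A, hA, hAcard⟩ := hA
  have hx : ∀ a : Set.Iic p₀, ∃ x ∈ R, x ≤ a.1 :=
    fun a => hR _ fun β hβ => le_trans a.2 (hp₀ β hβ)
  choose x hxR hxa using hx
  -- Each answer lies below the element of A it comes from, so the answers remain an antichain,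
  -- still of size at least |P|.
  have hta : ∀ a, t (x a) ≤ a.1 := fun a => (ht _ (hxR a).1).trans (hxa a)
  have hinc : ∀ a ∈ A, ∀ b ∈ A, a ≠ b → Incompatible (t (x a)) (t (x b)) := by
    rintro a ha b hb hab ⟨r, h₁, h₂⟩
    exact hA ha hb hab ⟨⟨r, (h₁.trans (hta a)).trans a.2⟩, h₁.trans (hta a), h₂.trans (hta b)⟩
  have hanti : Set.Pairwise ((fun a => t (x a)) '' A) Incompatible := by
    rintro _ ⟨a, ha, rfl⟩ _ ⟨b, hb, rfl⟩ hab
    exact hinc a ha b hb fun h => hab (by rw [h])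
  have hinj : Set.InjOn (fun a => t (x a)) A := by
    intro a ha b hb hab
    by_contra hne
    exact hinc a ha b hb hne ⟨t (x a), le_rfl, hab.le⟩
  -- Maximality is taken only among answers to legal moves in D. This suffices, because such answers
  -- are dense below the history.
  obtain ⟨B, hAB, hB⟩ := zorn_subset_nonempty
    {B : Set P | B ⊆ t '' R ∧ B.Pairwise Incompatible} (by
      intro C hC hchain _
      refine ⟨⋃₀ C, ⟨Set.sUnion_subset fun s hs => (hC hs).1, ?_⟩,
        fun s hs => Set.subset_sUnion_of_mem hs⟩
      exact (Set.pairwise_sUnion hchain.directedOn).2 fun s hs => (hC hs).2)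
    ((fun a => t (x a)) '' A) ⟨by
      rintro _ ⟨a, -, rfl⟩
      exact ⟨x a, hxR a, rfl⟩, hanti⟩
  have hcard : Cardinal.mk M = Cardinal.mk B := by
    rw [hM]
    refine le_antisymm (hAcard.trans ?_) (Cardinal.mk_set_le B)
    rw [← Cardinal.mk_image_eq_of_injOn _ _ hinj]
    exact Cardinal.mk_le_mk_of_subset hAB
  obtain ⟨f⟩ := Cardinal.eq.1 hcard
  choose c hcR hc using fun m => hB.prop.1 (f m).2
  refine ⟨c, fun m => (hcR m).1, fun m => (hcR m).2, fun m n hmn => ?_, fun p hp => ?_⟩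
  · rw [hc, hc]
    exact hB.prop.2 (f m).2 (f n).2 fun h => hmn (f.injective (Subtype.ext h))
  · obtain ⟨y, hyR, hyp⟩ := hR p hp
    have hty : t y ≤ p := (ht y hyR.1).trans hyp
    by_contra! hno
    have hno' : ∀ b ∈ B, Incompatible (t y) b := by
      rintro b hb ⟨r, h₁, h₂⟩
      refine hno (f.symm ⟨b, hb⟩) r (h₁.trans hty) ?_
      rwa [hc, Equiv.apply_symm_apply]
    have hins : insert (t y) B ⊆ B := hB.2 ⟨Set.insert_subset ⟨y, hyR, rfl⟩ hB.prop.1,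
      hB.prop.2.insert fun b hb _ => ⟨hno' b hb, (hno' b hb).symm⟩⟩ (Set.subset_insert _ _)
    exact hno' _ (hins (Set.mem_insert _ _)) ⟨t y, le_rfl, le_rfl⟩

end Step
/-! ### Trees of plays -/

section Tree

/-- Pairs `(γ, F)`, where only the values of `F` up to `γ < δ` matter, ordered by extension. -/
structure Node (δ : Ordinal.{v}) (M : Type u) where
  /-- the last element of the domain -/
  last : Ordinal.{v}
  last_lt : last < δ
  /-- the values -/
  val : Ordinal.{v} → M

variable {δ : Ordinal.{v}} {M : Type u}

instance : Preorder (Node δ M) where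
  le s t := t.last ≤ s.last ∧ ∀ a ≤ t.last, s.val a = t.val a
  le_refl _ := ⟨le_rfl, fun _ _ => rfl⟩
  le_trans _ _ _ h h' := ⟨h'.1.trans h.1, fun a ha => (h.2 a (ha.trans h'.1)).trans (h'.2 a ha)⟩

theorem Node.exists_ne_of_incompatible {s t : Node δ M} (h : Incompatible s t) :
    ∃ a, a ≤ s.last ∧ a ≤ t.last ∧ s.val a ≠ t.val a := by
  by_contra! hst
  rcases le_total s.last t.last with hle | hle
  · exact h ⟨t, ⟨hle, fun a ha => (hst a ha (ha.trans hle)).symm⟩, le_rfl⟩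
  · exact h ⟨s, le_rfl, ⟨hle, fun a ha => hst a (ha.trans hle) ha⟩⟩

theorem Node.incompatible_of_ne {s t : Node δ M} {a : Ordinal.{v}} (hs : a ≤ s.last)
    (ht : a ≤ t.last) (hne : s.val a ≠ t.val a) : Incompatible s t :=
  fun ⟨_, h₁, h₂⟩ => hne ((h₁.2 a hs).symm.trans (h₂.2 a ht))

variable {P : Type u} [Preorder P] {τ : StrategyII.{u, v} P}

/-- A tree of plays according to `τ`, one for each branch `F`, in which the answers in each round
form maximal antichains below the history, contained in `D`. -/
structure PlayTree (τ : StrategyII.{u, v} P) (δ : Ordinal.{v}) (M : Type u)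
    (D : Ordinal.{v} → Set P) where
  /-- the play along a branch -/
  run : (Ordinal.{v} → M) → Ordinal.{v} → P × P
  follows : ∀ F, FollowsUpTo τ δ (run F)
  congr : ∀ F G α, (∀ β ≤ α, F β = G β) → run F α = run G α
  mem : ∀ F, ∀ α < δ, (run F α).2 ∈ D α
  incompatible : ∀ F G, ∀ α < δ, (∀ β < α, F β = G β) → F α ≠ G α →
    Incompatible (run F α).2 (run G α).2
  maximal : ∀ F, ∀ α < δ, ∀ p, (∀ β < α, p ≤ (run F β).2) →
    ∃ m, ∃ r ≤ p, r ≤ (run (Function.update F α m) α).2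

/-- Recursion along branches: a branch F picks, in round γ, the member of the maximal antichain with
index `F γ`. -/
theorem IsWinningII.exists_playTree (hτ : IsWinningII τ δ)
    (hcc : NowhereChainCondition P (Cardinal.mk P)) (hM : Cardinal.mk M = Cardinal.mk P)
    [Nonempty P] {D : Ordinal.{v} → Set P} (hD : ∀ α < δ, IsOpenDense (D α)) :
    Nonempty (PlayTree τ δ M D) := by
  -- The antichain is chosen from the history h alone, so branches that agree before γ use the same
  -- one.
  have hstep : ∀ (γ : Ordinal.{v}) (h : Set.Iio γ → P × P), ∃ c : M → P,
      ∀ run : Ordinal.{v} → P × P, (fun β : Set.Iio γ => run β.1) = h → γ < δ →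
      FollowsUpTo τ γ run →
        (∀ m, ∀ β < γ, c m ≤ (run β).2) ∧ (∀ m, c m ∈ D γ) ∧
        (∀ m n, m ≠ n → Incompatible (τ γ h (c m)) (τ γ h (c n))) ∧
        ∀ p, (∀ β < γ, p ≤ (run β).2) → ∃ m, ∃ r, r ≤ p ∧ r ≤ τ γ h (c m) := by
    intro γ h
    by_cases hex : ∃ run : Ordinal.{v} → P × P, (fun β : Set.Iio γ => run β.1) = h ∧ γ < δ ∧
        FollowsUpTo τ γ run
    · obtain ⟨run, rfl, hγ, hrun⟩ := hex
      obtain ⟨c, hc⟩ := hτ.exists_maximal_antichain hcc hM hγ hrun (hD γ hγ)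
      refine ⟨c, fun run' hh _ _ => ?_⟩
      have hh' : ∀ β < γ, run' β = run β := fun β hβ => congrFun hh ⟨β, hβ⟩
      refine ⟨fun m β hβ => ?_, hc.2.1, hc.2.2.1, fun p hp => hc.2.2.2 p fun β hβ => ?_⟩
      · rw [hh' β hβ]
        exact hc.1 m β hβ
      · rw [← hh' β hβ]
        exact hp β hβ
    · exact ⟨fun _ => Classical.arbitrary P,
        fun run h₁ h₂ h₃ => (hex ⟨run, h₁, h₂, h₃⟩).elim⟩
  choose C hC using hstep
  let E : (Ordinal.{v} → M) → Ordinal.{v} → P × P := fun F => play τ fun γ h => C γ h (F γ)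
  have hfst : ∀ F α, (E F α).1 = C α (fun β => E F β.1) (F α) := fun F α =>
    play_fst τ (fun γ h => C γ h (F γ)) α
  have hsnd : ∀ F α, (E F α).2 = τ α (fun β => E F β.1) (C α (fun β => E F β.1) (F α)) :=
    fun F α => by rw [← hfst]; exact play_snd τ (fun γ h => C γ h (F γ)) α
  have hfol : ∀ F, FollowsUpTo τ δ (E F) := fun F => followsUpTo_play fun γ hγ hrun β hβ => by
    rw [play_fst]
    exact (hC γ _ _ rfl hγ hrun).1 _ β hβ
  have hC' : ∀ F, ∀ α < δ, _ := fun F α hα => hC α _ (E F) rfl hα ((hfol F).mono hα.le)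
  have hcongr : ∀ F G α, (∀ β ≤ α, F β = G β) → E F α = E G α := by
    intro F G α
    induction α using WellFoundedLT.induction with
    | ind α ih =>
      intro h
      have hh : (fun β : Set.Iio α => E F β.1) = fun β : Set.Iio α => E G β.1 :=
        funext fun β => ih β.1 β.2 fun ξ hξ => h ξ (hξ.trans (le_of_lt β.2))
      refine Prod.ext ?_ ?_
      · rw [hfst, hfst, hh, h α le_rfl]
      · rw [hsnd, hsnd, hh, h α le_rfl]
  have hhist : ∀ F G α, (∀ β < α, F β = G β) →
      (fun β : Set.Iio α => E F β.1) = fun β : Set.Iio α => E G β.1 := fun F G α h =>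
    funext fun β => hcongr F G β.1 fun ξ hξ => h ξ (hξ.trans_lt β.2)
  refine ⟨⟨E, hfol, hcongr, fun F α hα => ?_, fun F G α hα h hne => ?_, fun F α hα p hp => ?_⟩⟩
  · refine (hD α hα).lower (hτ.snd_le_fst (hfol F) hα) ?_
    rw [hfst]
    exact (hC' F α hα).2.1 _
  · rw [hsnd, hsnd, ← hhist F G α h]
    exact (hC' F α hα).2.2.1 _ _ hne
  · obtain ⟨m, r, hr, hrm⟩ := (hC' F α hα).2.2.2 p hp
    refine ⟨m, r, hr, ?_⟩
    rw [hsnd, ← hhist F (Function.update F α m) α fun β hβ => by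
      rw [Function.update_of_ne hβ.ne], Function.update_self]
    exact hrm

namespace PlayTree

variable {D : Ordinal.{v} → Set P}

/-- The condition attached to a node. -/
def cond (S : PlayTree τ δ M D) (s : Node δ M) : P := (S.run s.val s.last).2

theorem cond_mono (S : PlayTree τ δ M D) (hτ : IsWinningII τ δ) : Monotone S.cond := by
  intro s t h
  unfold cond
  rw [← S.congr s.val t.val t.last h.2]
  exact hτ.antitone (S.follows _) s.last_lt h.1

/-- At the least coordinate where the nodes differ the histories agree, so the two answers are
distinct members of one antichain; later answers only get stronger. -/
theorem cond_incompatible (S : PlayTree τ δ M D) (hτ : IsWinningII τ δ) (s t : Node δ M)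
    (h : Incompatible s t) : Incompatible (S.cond s) (S.cond t) := by
  let A : Set Ordinal.{v} := {a | a ≤ s.last ∧ a ≤ t.last ∧ s.val a ≠ t.val a}
  have hA : A.Nonempty := Node.exists_ne_of_incompatible h
  obtain ⟨h₁, h₂, h₃⟩ := wellFounded_lt.min_mem A hA
  set a := wellFounded_lt.min A hA
  refine (S.incompatible s.val t.val a (h₁.trans_lt s.last_lt) (fun β hβ => ?_) h₃).mono
    (hτ.antitone (S.follows _) s.last_lt h₁) (hτ.antitone (S.follows _) t.last_lt h₂)
  by_contra hne
  exact wellFounded_lt.not_lt_min A (x := β) ⟨hβ.le.trans h₁, hβ.le.trans h₂, hne⟩ hβ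

/-- The conditions below some node of level `α`. -/
def level (S : PlayTree τ δ M D) (α : Ordinal.{v}) : Set P := {q | ∃ F, q ≤ (S.run F α).2}

/-- By induction and distributivity, some q ≤ p lies below a node of each earlier level. These nodes
cohere into one history, and q meets the maximal antichain below it. -/
theorem isOpenDense_level (S : PlayTree τ δ M D) (hτ : IsWinningII τ δ) [Nonempty M]
    {α : Ordinal.{v}} (hα : α < δ) : IsOpenDense (S.level α) := by
  induction α using WellFoundedLT.induction with
  | ind α ih =>
    refine ⟨fun _ _ h ⟨F, hF⟩ => ⟨F, h.trans hF⟩, fun p => ?_⟩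
    obtain ⟨q, hqp, hq⟩ := hτ.distributive hα (fun β hβ => ih β hβ (hβ.trans hα)) p
    have hF : ∀ β, ∃ F, β < α → q ≤ (S.run F β).2 := by
      intro β
      by_cases hβ : β < α
      · exact (hq β hβ).imp fun _ h _ => h
      · exact ⟨fun _ => Classical.arbitrary M, fun h => (hβ h).elim⟩
    choose F hF using hF
    -- The diagonal glues the branches: nodes above the common condition q are compatible, so they
    -- agree where both are defined.
    have hrun : ∀ β < α, q ≤ (S.run (fun ξ => F ξ ξ) β).2 := by
      intro β hβ
      rw [S.congr (fun ξ => F ξ ξ) (F β) β fun ξ hξ => ?_]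
      · exact hF β hβ
      · by_contra hne
        have hξα := hξ.trans_lt hβ
        exact S.cond_incompatible hτ ⟨ξ, hξα.trans hα, F ξ⟩ ⟨β, hβ.trans hα, F β⟩
          (Node.incompatible_of_ne le_rfl hξ hne) ⟨q, hF ξ hξα, hF β hβ⟩
    obtain ⟨m, r, hr, hrm⟩ := S.maximal _ α hα q hrun
    exact ⟨r, hr.trans hqp, _, hrm⟩

/-- If `cond` has dense range, then no condition lies below a node of every level. -/
theorem exists_notMem_level (S : PlayTree τ δ M D) (hS : IsDenseEmbedding S.cond)
    [Nontrivial M] (hδ : Order.IsSuccLimit δ) (q : P) : ∃ α < δ, q ∉ S.level α := by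
  by_contra! hq
  obtain ⟨s, hs⟩ := hS.dense q
  have hlt : s.last < s.last + 1 := Order.lt_add_one_iff.2 le_rfl
  have hs1 : s.last + 1 < δ := hδ.add_one_lt s.last_lt
  obtain ⟨G, hG⟩ := hq _ hs1
  -- Extending s by a value other than that of G yields a node whose condition lies below q, hence
  -- below a node incompatible with it.
  obtain ⟨m, hm⟩ := exists_ne (G (s.last + 1))
  let s' : Node δ M := ⟨s.last + 1, hs1, Function.update s.val (s.last + 1) m⟩
  have hs' : s' ≤ s := ⟨hlt.le, fun a ha => Function.update_of_ne (ha.trans_lt hlt).ne _ _⟩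
  refine hS.incompatible s' ⟨s.last + 1, hs1, G⟩ (Node.incompatible_of_ne le_rfl le_rfl ?_)
    ⟨S.cond s', le_rfl, ((hS.mono hs').trans hs).trans hG⟩
  simpa [s'] using hm

end PlayTree

end Tree

/-! ### Deciding the values of a collapsing function -/

section Name

variable {P : Type u} [Preorder P] {X Y : Type v}

theorem ForcesMem.mono {p q : P} {x : X} {ν : SubsetName P X} (h : ForcesMem p x ν)
    (hq : q ≤ p) : ForcesMem q x ν :=
  fun r hr => h r (hr.trans hq)

/-- The conditions which decide the value at `x` of a function with values in `P`, and which are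
below this value or incompatible with it. -/
def deciding (ν : SubsetName P (X × Y)) (φ : Y → P) (x : X) : Set P :=
  {q | ∃ y, ForcesMem q (x, y) ν ∧ (q ≤ φ y ∨ Incompatible q (φ y))}

theorem isOpenDense_deciding {ν : SubsetName P (X × Y)} (hν : ∀ p : P, ForcesSurjection p ν)
    (φ : Y → P) (x : X) : IsOpenDense (deciding ν φ x) := by
  constructor
  · rintro q r hr ⟨y, hy, h⟩
    exact ⟨y, hy.mono hr, h.imp hr.trans fun h => h.mono hr le_rfl⟩
  · intro p
    obtain ⟨r, hr, y, hy⟩ := (hν p).total x p le_rfl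
    by_cases h : Incompatible r (φ y)
    · exact ⟨r, hr, y, hy, Or.inr h⟩
    · obtain ⟨s, hsr, hs⟩ := not_not.1 h
      exact ⟨s, hsr.trans hr, y, hy.mono hsr, Or.inl hs⟩

/-- The value decided by q must be y, and r witnesses that q is compatible with `φ y`; this excludes
the incompatible alternative. -/
theorem le_of_mem_deciding {ν : SubsetName P (X × Y)} (hν : ∀ p : P, ForcesSurjection p ν)
    {φ : Y → P} {x : X} {q r : P} {y : Y} (hq : q ∈ deciding ν φ x) (hrq : r ≤ q)
    (hr : ForcesMem r (x, y) ν) (hry : r ≤ φ y) : q ≤ φ y := by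
  obtain ⟨z, hz, h⟩ := hq
  obtain rfl : z = y := (hν r).functional x z y r le_rfl (hz.mono hrq) hr
  exact h.resolve_right fun h => h ⟨r, hrq, hry⟩

end Name

/-! ### The Levy collapse -/

section Levy

open Cardinal

variable {κ μ : Cardinal.{u}}

/-- The condition of the Levy collapse given by a node. -/
noncomputable def Node.toCol (hκ : ℵ₀ ≤ κ) (s : Node.{u, u} κ.ord μ.ord.ToType) : Col κ μ where
  toFun a := if (Ordinal.ToType.mk.symm a).1 ≤ s.last then
    some (s.val (Ordinal.ToType.mk.symm a).1) else none
  card_dom_lt := by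
    refine lt_of_le_of_lt (mk_le_mk_of_subset
      (t := Set.Iic (Ordinal.ToType.mk ⟨s.last, s.last_lt⟩)) ?_) ?_
    · intro a ha
      by_contra h
      refine ha (if_neg fun h' => h ?_)
      rw [Set.mem_Iic, ← OrderIso.symm_apply_le]
      exact h'
    · simpa using mk_Iic_lt (Ordinal.ToType.mk ⟨s.last, s.last_lt⟩ : κ.ord.ToType) (by simp)
        (by simpa using hκ)

theorem Node.toCol_apply_of_le (hκ : ℵ₀ ≤ κ) {s : Node.{u, u} κ.ord μ.ord.ToType} {a : κ.ord.ToType}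
    (h : (Ordinal.ToType.mk.symm a).1 ≤ s.last) :
    (s.toCol hκ).toFun a = some (s.val (Ordinal.ToType.mk.symm a).1) := if_pos h

theorem Node.toCol_apply_eq_some (hκ : ℵ₀ ≤ κ) {s : Node.{u, u} κ.ord μ.ord.ToType} {a : κ.ord.ToType}
    {b : μ.ord.ToType} : (s.toCol hκ).toFun a = some b ↔
      (Ordinal.ToType.mk.symm a).1 ≤ s.last ∧ s.val (Ordinal.ToType.mk.symm a).1 = b := by
  by_cases h : (Ordinal.ToType.mk.symm a).1 ≤ s.last
  · simp [toCol_apply_of_le hκ h, h]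
  · simp [toCol, h]

/-- Regularity is what gives density: a domain of size less than κ is bounded, and the gaps below
its supremum can be filled arbitrarily. -/
theorem isDenseEmbedding_toCol (hκ : ℵ₀ ≤ κ) (hreg : κ ≤ κ.ord.cof)
    [Nonempty μ.ord.ToType] :
    IsDenseEmbedding (Node.toCol hκ : Node.{u, u} κ.ord μ.ord.ToType → Col κ μ) := by
  refine ⟨fun s t h a b hab => ?_, fun s t h => ?_, fun p => ?_⟩
  · rw [Node.toCol_apply_eq_some hκ] at hab ⊢
    exact ⟨hab.1.trans h.1, (h.2 _ hab.1).trans hab.2⟩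
  · obtain ⟨a, has, hat, hne⟩ := Node.exists_ne_of_incompatible h
    rintro ⟨r, hrs, hrt⟩
    let x : κ.ord.ToType := Ordinal.ToType.mk ⟨a, has.trans_lt s.last_lt⟩
    have hx : (Ordinal.ToType.mk.symm x).1 = a := by simp [x]
    have h₁ := hrs x (s.val a) ((Node.toCol_apply_eq_some hκ).2 (by rw [hx]; exact ⟨has, rfl⟩))
    have h₂ := hrt x (t.val a) ((Node.toCol_apply_eq_some hκ).2 (by rw [hx]; exact ⟨hat, rfl⟩))
    exact hne (Option.some.inj (h₁.symm.trans h₂))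
  · let dom := {a : κ.ord.ToType // p.toFun a ≠ none}
    let f : dom → Ordinal.{u} := fun a => (Ordinal.ToType.mk.symm a.1).1
    have hlt : ⨆ a, f a < κ.ord := Ordinal.iSup_lt_of_lt_cof (p.card_dom_lt.trans_le hreg)
      fun a => (Ordinal.ToType.mk.symm a.1).2
    classical
    refine ⟨⟨_, hlt, fun ξ => if h : ξ ∈ Set.Iio κ.ord then
      (p.toFun (Ordinal.ToType.mk ⟨ξ, h⟩)).getD (Classical.arbitrary _) else
      Classical.arbitrary _⟩, fun a b hab => (Node.toCol_apply_eq_some hκ).2 ⟨?_, ?_⟩⟩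
    · exact Ordinal.le_iSup f ⟨a, by simp [hab]⟩
    · simp only [Subtype.coe_prop, dite_true, Subtype.coe_eta, OrderIso.apply_symm_apply, hab,
        Option.getD_some]

theorem Col.compatible_of_subsingleton (hκ : ℵ₀ ≤ κ) [Subsingleton μ.ord.ToType]
    (p q : Col κ μ) : ∃ r, r ≤ p ∧ r ≤ q := by
  refine ⟨⟨fun a => (p.toFun a).or (q.toFun a), ?_⟩, fun a b h => ?_, fun a b h => ?_⟩
  · refine lt_of_le_of_lt (mk_le_mk_of_subset
      (t := {a | p.toFun a ≠ none} ∪ {a | q.toFun a ≠ none}) fun a ha => ?_)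
      ((mk_union_le _ _).trans_lt (add_lt_of_lt hκ p.card_dom_lt q.card_dom_lt))
    by_contra hno
    simp only [Set.mem_union, Set.mem_ofPred_eq, not_or, not_not] at hno
    exact ha (by simp [hno])
  · simp [h]
  · rcases hp : p.toFun a with _ | c
    · simp [hp, h]
    · simp [hp, Subsingleton.elim c b]

theorem isDenseEmbedding_const_of_subsingleton (hκ : ℵ₀ ≤ κ) [Subsingleton μ.ord.ToType]
    {P : Type v} [Preorder P] [Subsingleton P] (p : P) :
    IsDenseEmbedding fun _ : Col κ μ => p :=
  ⟨fun _ _ _ => le_rfl, fun s t h => (h (Col.compatible_of_subsingleton hκ s t)).elim,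
    fun q => ⟨⟨fun _ => none, by simpa using aleph0_pos.trans_le hκ⟩, (Subsingleton.elim p q).le⟩⟩

end Levy

/-! ### Density of the tree of plays and regularity of κ -/

theorem PlayTree.isDenseEmbedding_cond {P : Type u} [Preorder P] {τ : StrategyII.{u, u} P}
    {κ μ : Cardinal.{u}} [Nonempty μ.ord.ToType] (hτ : IsWinningII τ κ.ord)
    {ν : SubsetName P (κ.ord.ToType × μ.ord.ToType)} (hν : ∀ p : P, ForcesSurjection p ν)
    (φ : μ.ord.ToType ≃ P) {D : Ordinal.{u} → Set P}
    (hD : ∀ x : κ.ord.ToType, D (Ordinal.ToType.mk.symm x).1 ⊆ deciding ν φ x)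
    (S : PlayTree τ κ.ord μ.ord.ToType D) : IsDenseEmbedding S.cond := by
  refine ⟨S.cond_mono hτ, S.cond_incompatible hτ, fun p => ?_⟩
  obtain ⟨r, hrp, x, hx⟩ := (hν p).surjective (φ.symm p) p le_rfl
  have hlt : (Ordinal.ToType.mk.symm x).1 < κ.ord := (Ordinal.ToType.mk.symm x).2
  obtain ⟨r', hr', F, hF⟩ := (S.isOpenDense_level hτ hlt).dense r
  refine ⟨⟨_, hlt, F⟩, ?_⟩
  exact (le_of_mem_deciding hν (hD x (S.mem F _ hlt)) hF (hx.mono hr')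
    (by simpa using hr'.trans hrp)).trans_eq (φ.apply_symm_apply p)

/-- If κ were singular, distributivity over fewer than κ cofinal levels would give a condition below
a node of every level, which `exists_notMem_level` rules out. -/
theorem PlayTree.le_cof_ord {P : Type u} [Preorder P] [Nonempty P] {τ : StrategyII.{u, u} P}
    {κ : Cardinal.{u}} (hκ : Cardinal.aleph0 ≤ κ) {M : Type u} [Nontrivial M]
    (hτ : IsWinningII τ κ.ord) {D : Ordinal.{u} → Set P} (S : PlayTree τ κ.ord M D)
    (hS : IsDenseEmbedding S.cond) : κ ≤ κ.ord.cof := by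
  by_contra! hcof
  obtain ⟨f, hf⟩ := Ordinal.exists_isFundamentalSeq (o := κ.ord) rfl
  let g : Ordinal.{u} → Ordinal.{u} := fun β => if h : β < κ.ord.cof.ord then f ⟨β, h⟩ else 0
  have hg : ∀ β < κ.ord.cof.ord, g β < κ.ord := fun β hβ => by
    simp only [g, hβ, dite_true]
    exact (f ⟨β, hβ⟩).2
  obtain ⟨q, -, hq⟩ := hτ.distributive (Cardinal.ord_lt_ord.2 hcof)
    (U := fun β => S.level (g β)) (fun β hβ => S.isOpenDense_level hτ (hg β hβ))
    (Classical.arbitrary P)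
  obtain ⟨α, hα, hqα⟩ := S.exists_notMem_level hS (Cardinal.isSuccLimit_ord hκ) q
  obtain ⟨_, ⟨β, rfl⟩, hβ⟩ := hf.isCofinal_range ⟨α, hα⟩
  obtain ⟨F, hF⟩ := hq β.1 β.2
  have hle : α ≤ g β.1 := by
    simp only [g, dif_pos (show β.1 < κ.ord.cof.ord from β.2)]
    exact hβ
  exact hqα ⟨F, hF.trans (hτ.antitone (S.follows F) (hg _ β.2) hle)⟩

end Forcing

theorem lemma2 {P : Type u} [Preorder P] [Nonempty P] (κ : Cardinal.{u})
    (hκ : Cardinal.aleph0 ≤ κ)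
    (hstrat : Forcing.StronglyStrategicallyClosed P κ)
    (hcc : Forcing.NowhereChainCondition P (Cardinal.mk P))
    (hcol : Forcing.Collapses P (Cardinal.mk P) κ) :
    Forcing.ForcingEquivalent P (Forcing.Col κ (Cardinal.mk P)) := by
  obtain ⟨φ⟩ : Nonempty ((Cardinal.mk P).ord.ToType ≃ P) :=
    Cardinal.eq.1 (Cardinal.mk_ord_toType _)
  have : Nonempty (Cardinal.mk P).ord.ToType := φ.nonempty
  -- When |P| = 1 the tree does not branch and the regularity argument fails, but all conditions of
  -- the Levy collapse are compatible, so a constant map is a dense embedding.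
  rcases subsingleton_or_nontrivial (Cardinal.mk P).ord.ToType with hM | hM
  · have : Subsingleton P := φ.symm.subsingleton
    exact ⟨(Forcing.isDenseEmbedding_const_of_subsingleton hκ (Classical.arbitrary P)).orderIso⟩
  obtain ⟨τ, hτ⟩ := hstrat
  obtain ⟨ν, hν⟩ := hcol
  let D : Ordinal.{u} → Set P := fun α =>
    {q | ∀ x, (Ordinal.ToType.mk.symm x).1 = α → q ∈ Forcing.deciding ν φ x}
  have hD : ∀ x : κ.ord.ToType, D (Ordinal.ToType.mk.symm x).1 = Forcing.deciding ν φ x := by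
    intro x
    refine Set.ext fun q => ⟨fun h => h x rfl, fun h y hy => ?_⟩
    rwa [Ordinal.ToType.mk.symm.injective (Subtype.ext hy)]
  obtain ⟨S⟩ := hτ.exists_playTree hcc (Cardinal.mk_ord_toType _) (D := D) fun α hα => by
    have h := hD (Ordinal.ToType.mk ⟨α, hα⟩)
    rw [OrderIso.symm_apply_apply] at h
    rw [h]
    exact Forcing.isOpenDense_deciding hν φ _
  have hS : Forcing.IsDenseEmbedding S.cond :=
    S.isDenseEmbedding_cond hτ hν φ fun x => (hD x).le
  have hreg := S.le_cof_ord hκ hτ hS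
  exact ⟨hS.orderIso.trans (Forcing.isDenseEmbedding_toCol hκ hreg).orderIso.symm⟩
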